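/- A partition of $[0,1)$ is a countable family of pairwise disjoint measurable sets with union $[0,1)$. A filtration is a sequence $(\mathcal A_n)_{n\ge1}$ of partitions of $[0,1)$ such that every $A\in\mathcal A_n$ is a union of sets from $\mathcal A_{n+1}$. A martingale difference based on $(\mathcal A_n)$ is a sequence of integrable functions $f_n:[0,1)\to\mathbb R$, $n\ge 1$, such that $f_n$ is constant on each $A\in\mathcal A_n$, and $\int_A f_n=0$ for every $A\in\mathcal A_{n-1}$, $n\ge2$. For a system $\Phi=\{\phi_j\}_{j\ge1}\subset L^2(0,1)$, a monotonic sequence of $\Phi$-polynomials is a sequence $p_k=\sum_{j\in G_k}c_j\phi_j$, $k=1,\dots,n$, with real coefficients $c_j$ and finite sets $G_1\subseteq G_2\subseteq\dots\subseteq G_n\subset\mathbb N$. Put $$\kappa_n(\Phi)=\sup\frac{\bigl\|\max_{1\le m\le n}|p_m|\bigr\|_2}{\|p_n\|_2},$$ the supremum being over all monotonic sequences of $\Phi$-polynomials $p_1,\dots,p_n$ with $\sum_{j\in G_n}c_j^2\ne0$ (with the convention $0/0=0$). **Theorem.** There is an absolute constant $C>0$ such that for every martingale difference $\Phi=\{f_j\}\subset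 L^2(0,1)$ (based on any filtration), every $n\ge2$ and every monotonic sequence $p_1,\dots,p_n$ of $\Phi$-polynomials, $$\Bigl\|\max_{1\le m\le n}|p_m|\Bigr\|_2\le C\sqrt{\log_2 n}\;\|p_n\|_2 ,$$ and consequently $\kappa_n(\Phi)\le C\sqrt{\log_2 n}$. -/

import Mathlib

open MeasureTheory
open scoped ENNReal NNReal

/-- Lebesgue measure on `[0,1)`. -/
noncomputable def unitMeasure : Measure ℝ := volume.restrict (Set.Ico 0 1)

/-- A (countable, measurable) partition of `[0,1)`. -/
structure IsUnitPartition (P : Set (Set ℝ)) : Prop where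
  countable : P.Countable
  measurableSet : ∀ A ∈ P, MeasurableSet A
  pairwiseDisjoint : P.PairwiseDisjoint id
  sUnion_eq : ⋃₀ P = Set.Ico (0 : ℝ) 1

/-- A filtration: a sequence of partitions of `[0,1)` such that every set of the `n`-th partition
is a union of sets of the `(n+1)`-st one. -/
structure IsPartitionFiltration (P : ℕ → Set (Set ℝ)) : Prop where
  isUnitPartition : ∀ n, IsUnitPartition (P n)
  children : ∀ n, ∀ A ∈ P n, ∃ S : Set (Set ℝ), S ⊆ P (n + 1) ∧ A = ⋃₀ S

/-- `f` is a martingale difference based on the filtration `P`. Indices start at `0`, so `f 0` is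
the first function, whose mean value is not prescribed. -/
structure IsMartingaleDifferenceOn (P : ℕ → Set (Set ℝ)) (f : ℕ → ℝ → ℝ) : Prop where
  filtration : IsPartitionFiltration P
  integrable : ∀ n, Integrable (f n) unitMeasure
  const : ∀ n, ∀ A ∈ P n, ∀ x ∈ A, ∀ y ∈ A, f n x = f n y
  integral_eq_zero : ∀ n, ∀ A ∈ P n, ∫ x in A, f (n + 1) x = 0

/-- `f` is a martingale difference. -/
def IsMartingaleDifference (f : ℕ → ℝ → ℝ) : Prop :=
  ∃ P : ℕ → Set (Set ℝ), IsMartingaleDifferenceOn P f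

/-- The `Φ`-polynomial `∑ j ∈ G, c j • φ j`. -/
def systemPoly (φ : ℕ → ℝ → ℝ) (c : ℕ → ℝ) (G : Finset ℕ) (x : ℝ) : ℝ :=
  ∑ j ∈ G, c j * φ j x

/-- The maximal function `max_{1 ≤ m ≤ n} |p m x|` (the maximum of finitely many nonnegative
reals, computed in `ℝ≥0`). -/
noncomputable def maxAbs (n : ℕ) (p : ℕ → ℝ → ℝ) (x : ℝ) : ℝ :=
  ((Finset.Icc 1 n).sup (fun m => ‖p m x‖₊) : ℝ≥0)

/-- `κ_n(Φ)`: the supremum, in `[0,∞]`, of `‖max_{1≤m≤n} |p_m|‖₂ / ‖p_n‖₂` over all monotonic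
sequences of `Φ`-polynomials `p_m = ∑_{j ∈ G_m} c_j φ_j`, `G_1 ⊆ … ⊆ G_n`, with
`∑_{j ∈ G_n} c_j² ≠ 0`. -/
noncomputable def kappa (n : ℕ) (φ : ℕ → ℝ → ℝ) : ℝ≥0∞ :=
  ⨆ (c : ℕ → ℝ) (G : ℕ → Finset ℕ) (_ : MonotoneOn G (Set.Icc 1 n))
    (_ : ∑ j ∈ G n, c j ^ 2 ≠ 0),
    eLpNorm (maxAbs n (fun m => systemPoly φ c (G m))) 2 unitMeasure /
      eLpNorm (systemPoly φ c (G n)) 2 unitMeasure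

/-!
The proof rests on a self-normalized exponential inequality. For a square-integrable martingale
`X = ∑ j ∈ G, g j` let `V` be its total variance, the sum over `j ∈ G` of `(g j)²` and of the
conditional expectation of `(g j)²` given the past, so that `∫ V ≤ 2 ∫ X²`. Then
`∫ V exp (X² / (16 V)) ≤ C ∫ X²`
(`IsSqMartingaleDifference.integral_gaussPotential_le`). This is proved by following the potential
`v exp (x² / (16 v))` along the martingale. When `x` moves by an increment `d` of conditional mean
`0` and conditional variance `s`, and `v` grows by `d² + s`, the convexity gain in `x` is paid for
by the growth of `v` in the denominator of the exponent, and the mean of the potential grows by at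
most a constant times `s`. The pointwise form of this (`gaussPotential_add_le`, `stepConst_add_le`)
bounds the new potential by a quadratic polynomial in `d` with coefficients depending on the past.
Including the conditional variance in `V` is what makes the inequality true for martingales whose
differences are not conditionally symmetric.

The maximal inequality follows by convexity. Let `X_m`, `V_m` belong to the set `G m`. Young's
inequality gives `X_m² / 16 ≤ V_m log n + V_m exp (X_m² / (16 V_m)) / n`. As `G m ⊆ G n`, `V_m` is
at most `V_n`, and the last term is at most the sum over all `m`, whose integral is at most
`C n ∫ X_n²` by orthogonality; so `∫ max X_m² ≤ 16 (2 log n + C) ∫ X_n²`. Only the inclusions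
`G m ⊆ G n` are used.

A martingale difference based on partitions is one for the σ-algebras of the Borel sets that do not
split the sets of the partitions, after the functions are set to `0` outside `[0,1)`.
-/

/-! ### The potential and its one-step inequality -/

/-- The potential `v * exp (x² / (16 v))`, to be evaluated at a martingale `x` and its accumulated
(quadratic plus conditional) variance `v`. It vanishes at `v = 0` because of `x² / 0 = 0`. -/
noncomputable def gaussPotential (x v : ℝ) : ℝ := v * Real.exp (x ^ 2 / (16 * v))

lemma Real.exp_sub_sq_le (u : ℝ) : Real.exp (u - u ^ 2) ≤ 1 + u + u ^ 2 := by
  have h1 : 1 - u + u ^ 2 ≤ Real.exp (-(u - u ^ 2)) := by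
    have := Real.add_one_le_exp (-(u - u ^ 2))
    linarith
  have h2 : 0 < 1 - u + u ^ 2 := by nlinarith [sq_nonneg (u - 1 / 2)]
  rw [Real.exp_neg] at h1
  have h3 : Real.exp (u - u ^ 2) ≤ (1 - u + u ^ 2)⁻¹ := by
    rwa [le_inv_comm₀ (Real.exp_pos _) h2]
  refine h3.trans ?_
  rw [inv_le_iff_one_le_mul₀ h2]
  nlinarith [sq_nonneg u, sq_nonneg (u ^ 2)]

/-- A large increment (`d² + s ≥ 1` for the unit variance) lowers the exponent by so much that only
a small multiple of a smaller exponential remains. -/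
lemma potential_le_of_large {x d s : ℝ} (hs : 0 ≤ s) (hz : 1 ≤ d ^ 2 + s) :
    (1 + d ^ 2 + s) * Real.exp ((x + d) ^ 2 / (16 * (1 + d ^ 2 + s))) ≤
      3 / 4 * Real.exp (3 / 4 * (x ^ 2 / 16)) + 2 * Real.exp 21 * (d ^ 2 + s) := by
  set w := 1 + d ^ 2 + s with hw
  set t := x ^ 2 / 16 with ht
  have ht0 : 0 ≤ t := by positivity
  have hw2 : 2 ≤ w := by linarith
  have hw0 : 0 < w := by linarith
  have hexp : (x + d) ^ 2 / (16 * w) ≤ 5 / 4 * (t / w) + 5 / 16 := by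
    have h1 : (x + d) ^ 2 ≤ 5 / 4 * x ^ 2 + 5 * d ^ 2 := by nlinarith [sq_nonneg (x - 4 * d)]
    have h2 : 5 / 4 * (t / w) + 5 / 16 = (5 / 4 * x ^ 2 + 5 * w) / (16 * w) := by
      rw [ht]; field_simp
    rw [h2]
    gcongr
    nlinarith
  have h34 : Real.exp (5 / 16) ≤ 3 / 2 := by
    have h := Real.exp_bound' (x := 5 / 16) (by norm_num) (by norm_num) (n := 3) (by norm_num)
    refine h.trans ?_
    norm_num [Finset.sum_range_succ, Nat.factorial]
  have hpos : 0 ≤ 3 / 4 * Real.exp (3 / 4 * t) := by positivity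
  rcases le_or_gt t (16 * w) with h | h
  · have h3 : t / w ≤ 16 := by rw [div_le_iff₀ hw0]; exact h
    have h4 : Real.exp ((x + d) ^ 2 / (16 * w)) ≤ Real.exp 21 := Real.exp_le_exp.2 (by linarith)
    calc w * Real.exp ((x + d) ^ 2 / (16 * w)) ≤ (2 * (d ^ 2 + s)) * Real.exp 21 := by
          gcongr; linarith
      _ ≤ _ := by nlinarith
  · have h3 : t / w ≤ t / 2 := by gcongr
    have h4 : Real.exp ((x + d) ^ 2 / (16 * w)) ≤ Real.exp (5 / 8 * t) * Real.exp (5 / 16) := by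
      rw [← Real.exp_add]; exact Real.exp_le_exp.2 (by linarith)
    have h5 : w ≤ 1 / 2 * Real.exp (t / 8) := by
      have := Real.add_one_le_exp (t / 8)
      linarith
    have h6 : Real.exp (3 / 4 * t) = Real.exp (t / 8) * Real.exp (5 / 8 * t) := by
      rw [← Real.exp_add]; congr 1; ring
    calc w * Real.exp ((x + d) ^ 2 / (16 * w))
        ≤ (1 / 2 * Real.exp (t / 8)) * (Real.exp (5 / 8 * t) * (3 / 2)) := by
          gcongr
          exact h4.trans (by gcongr)
      _ = 3 / 4 * Real.exp (3 / 4 * t) := by rw [h6]; ring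
      _ ≤ _ := by
        have : 0 ≤ 2 * Real.exp 21 * (d ^ 2 + s) := by positivity
        linarith

/-- For a small increment (`d² + s ≤ 1` for the unit variance), the growth of the variance pays for
the second order term of the exponential. -/
lemma potential_le_of_small {x d s : ℝ} (hs : 0 ≤ s) (hz : d ^ 2 + s ≤ 1) :
    (1 + d ^ 2 + s) * Real.exp ((x + d) ^ 2 / (16 * (1 + d ^ 2 + s))) ≤
      Real.exp (x ^ 2 / 16 - x ^ 2 / 16 * s / 4) * (1 + x * d / 8 + (x * d / 8) ^ 2) +
        2 * Real.exp 21 * (d ^ 2 + s) := by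
  set z := d ^ 2 + s with hzdef
  set t := x ^ 2 / 16 with ht
  set u := x * d / 8 with hu
  have ht0 : 0 ≤ t := by positivity
  have hz0 : 0 ≤ z := by positivity
  have hw : 1 + d ^ 2 + s = 1 + z := by rw [hzdef]; ring
  rw [hw]
  have hu2 : u ^ 2 = t * d ^ 2 / 4 := by rw [hu, ht]; ring
  -- The exponent of the left-hand side, linearized in `d` with the variance gain `- 3/8 t z`.
  have hexp : z + (x + d) ^ 2 / (16 * (1 + z)) ≤ t + u - 3 / 8 * (t * z) + 2 * z := by
    have h1 : (x + d) ^ 2 / (16 * (1 + z)) = (t + u + d ^ 2 / 16) / (1 + z) := by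
      rw [ht, hu]; field_simp; ring
    have h2 : -u ≤ t / 8 + d ^ 2 / 2 := by
      rw [ht, hu]; nlinarith [sq_nonneg (x + 8 * d)]
    have hd1 : d ^ 2 ≤ z := by linarith
    have h3 : (t + u + d ^ 2 / 16) / (1 + z) ≤ t + u - 3 / 8 * (t * z) + z := by
      rw [div_le_iff₀ (by linarith)]
      have e1 : (t + u - 3 / 8 * (t * z) + z) * (1 + z) - (t + u + d ^ 2 / 16) =
        (z - d ^ 2 / 16) + z ^ 2 + z * (u + t * (5 / 8 - 3 / 8 * z)) := by ring
      have e2 : -(d ^ 2 / 2) ≤ u + t * (5 / 8 - 3 / 8 * z) := by nlinarith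
      have e3 := mul_le_mul_of_nonneg_left e2 hz0
      nlinarith
    rw [h1]; linarith
  have hLHS : (1 + z) * Real.exp ((x + d) ^ 2 / (16 * (1 + z))) ≤
      Real.exp (t + u - 3 / 8 * (t * z) + 2 * z) := by
    calc _ ≤ Real.exp z * Real.exp ((x + d) ^ 2 / (16 * (1 + z))) := by
          gcongr
          linarith [Real.add_one_le_exp z]
      _ ≤ _ := by rw [← Real.exp_add]; exact Real.exp_le_exp.2 hexp
  have hmain : Real.exp (t + u - 1 / 4 * (t * z)) ≤
      Real.exp (t - t * s / 4) * (1 + u + u ^ 2) := by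
    have : t + u - 1 / 4 * (t * z) = (t - t * s / 4) + (u - u ^ 2) := by
      rw [hu2, hzdef]; ring
    rw [this, Real.exp_add]
    gcongr
    exact Real.exp_sub_sq_le u
  refine hLHS.trans ?_
  rcases le_or_gt 16 t with h | h
  · have h1 : t + u - 3 / 8 * (t * z) + 2 * z ≤ t + u - 1 / 4 * (t * z) := by nlinarith
    have h2 : 0 ≤ 2 * Real.exp 21 * z := by positivity
    linarith [Real.exp_le_exp.2 h1]
  · have hu3 : u ≤ 2 := by
      have : u ^ 2 ≤ 2 ^ 2 := by
        rw [hu2]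
        nlinarith [sq_nonneg d]
      exact (le_abs_self u).trans (abs_le_of_sq_le_sq this (by norm_num))
    have he2 : Real.exp (2 * z) ≤ 1 + Real.exp 2 * z := by
      have hc := convexOn_exp.2 (Set.mem_univ 0) (Set.mem_univ 2)
        (show 0 ≤ 1 - z by linarith) hz0 (by ring)
      simp only [smul_eq_mul, mul_zero, zero_add, Real.exp_zero, mul_one] at hc
      rw [mul_comm z 2] at hc
      linarith
    have htz : 0 ≤ t * z := by positivity
    have h18 : Real.exp (t + u - 1 / 4 * (t * z)) ≤ Real.exp 18 :=
      Real.exp_le_exp.2 (by linarith)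
    have h20 : Real.exp 18 * Real.exp 2 ≤ 2 * Real.exp 21 := by
      rw [← Real.exp_add]
      have := Real.exp_le_exp.2 (show (18 : ℝ) + 2 ≤ 21 by norm_num)
      linarith [Real.exp_pos 21]
    calc Real.exp (t + u - 3 / 8 * (t * z) + 2 * z)
        ≤ Real.exp (t + u - 1 / 4 * (t * z)) * Real.exp (2 * z) := by
          rw [← Real.exp_add]; exact Real.exp_le_exp.2 (by linarith)
      _ ≤ Real.exp (t + u - 1 / 4 * (t * z)) * (1 + Real.exp 2 * z) := by gcongr
      _ = Real.exp (t + u - 1 / 4 * (t * z)) +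
          Real.exp (t + u - 1 / 4 * (t * z)) * Real.exp 2 * z := by ring
      _ ≤ Real.exp (t + u - 1 / 4 * (t * z)) + Real.exp 18 * Real.exp 2 * z := by gcongr
      _ ≤ _ := by
        have := mul_le_mul_of_nonneg_right h20 hz0
        linarith

/-- The factor `exp (x² / (16 v) - x² s / (64 v²))` of the bound for the potential after an
increment of conditional variance `s`, cut off to `0` for `s > v`. -/
noncomputable def stepFactor (x v s : ℝ) : ℝ :=
  if s ≤ v then Real.exp (x ^ 2 / (16 * v) - x ^ 2 * s / (64 * v ^ 2)) else 0

/-- The constant term, as a polynomial in the increment `d`, of the bound for the potential. -/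
noncomputable def stepConst (x v s : ℝ) : ℝ :=
  if s ≤ v then v * stepFactor x v s else gaussPotential x v

lemma stepFactor_nonneg (x v s : ℝ) : 0 ≤ stepFactor x v s := by
  unfold stepFactor; split_ifs <;> positivity

/-- The potential after an increment `d` is at most a quadratic polynomial in `d` whose coefficients
depend only on the past, up to a multiple of the growth of the variance. -/
lemma gaussPotential_add_le {x v d s : ℝ} (hs : 0 ≤ s) (hv : 0 ≤ v) (hx : v = 0 → x = 0) :
    gaussPotential (x + d) (v + (d ^ 2 + s)) ≤
      stepConst x v s + x / 8 * stepFactor x v s * d +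
        x ^ 2 / (64 * v) * stepFactor x v s * d ^ 2 + 2 * Real.exp 21 * (d ^ 2 + s) := by
  rcases hv.eq_or_lt with hv0 | hv0
  · have hx0 := hx hv0.symm
    subst hx0 hv0
    have h0 : stepConst 0 0 s = 0 := by simp [stepConst, gaussPotential]
    rw [h0]
    have h1 : d ^ 2 / (16 * (d ^ 2 + s)) ≤ 21 :=
      div_le_of_le_mul₀ (by positivity) (by norm_num) (by nlinarith [sq_nonneg d])
    have h2 := Real.exp_le_exp.2 h1
    have h3 : 0 ≤ d ^ 2 + s := by positivity
    simp only [gaussPotential, zero_add, zero_div, zero_mul, ne_eq, OfNat.ofNat_ne_zero,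
      not_false_eq_true, zero_pow]
    nlinarith [mul_le_mul_of_nonneg_left h2 h3, Real.exp_pos 21]
  · -- Rescale to unit variance.
    obtain ⟨r, hr, rfl⟩ : ∃ r : ℝ, 0 < r ∧ v = r ^ 2 :=
      ⟨√v, Real.sqrt_pos.2 hv0, (Real.sq_sqrt hv).symm⟩
    obtain ⟨x, rfl⟩ : ∃ y, x = r * y := ⟨x / r, by field_simp⟩
    obtain ⟨d, rfl⟩ : ∃ y, d = r * y := ⟨d / r, by field_simp⟩
    obtain ⟨s, rfl⟩ : ∃ y, s = r ^ 2 * y := ⟨s / r ^ 2, by field_simp⟩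
    have hs' : 0 ≤ s := nonneg_of_mul_nonneg_right hs hv0
    have hr2 : 0 < r ^ 2 := hv0
    have e1 : gaussPotential (r * x + r * d) (r ^ 2 + ((r * d) ^ 2 + r ^ 2 * s)) =
        r ^ 2 * ((1 + d ^ 2 + s) * Real.exp ((x + d) ^ 2 / (16 * (1 + d ^ 2 + s)))) := by
      have : 0 < 1 + d ^ 2 + s := by positivity
      have h1 : r ^ 2 + ((r * d) ^ 2 + r ^ 2 * s) = r ^ 2 * (1 + d ^ 2 + s) := by ring
      have h2 : (r * x + r * d) ^ 2 / (16 * (r ^ 2 * (1 + d ^ 2 + s))) =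
          (x + d) ^ 2 / (16 * (1 + d ^ 2 + s)) := by field_simp
      rw [gaussPotential, h1, h2]; ring
    have e2 : (r * x) ^ 2 / (16 * r ^ 2) = x ^ 2 / 16 := by field_simp
    have e3 : (r * x) ^ 2 * (r ^ 2 * s) / (64 * (r ^ 2) ^ 2) = x ^ 2 / 16 * s / 4 := by
      field_simp; ring
    have e4 : (r * x) ^ 2 / (64 * r ^ 2) = x ^ 2 / 64 := by field_simp
    have e5 : r ^ 2 * s ≤ r ^ 2 ↔ s ≤ 1 := by
      constructor
      · intro h; by_contra! h'; nlinarith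
      · intro h; nlinarith
    rw [e1, e4]
    simp only [stepConst, stepFactor, gaussPotential, e2, e3, e5]
    have key : (1 + d ^ 2 + s) * Real.exp ((x + d) ^ 2 / (16 * (1 + d ^ 2 + s))) ≤
        (if s ≤ 1 then Real.exp (x ^ 2 / 16 - x ^ 2 / 16 * s / 4) *
          (1 + x * d / 8 + (x * d / 8) ^ 2) else Real.exp (x ^ 2 / 16)) +
          2 * Real.exp 21 * (d ^ 2 + s) := by
      rcases le_total (d ^ 2 + s) 1 with hz | hz
      · rw [if_pos (by nlinarith [sq_nonneg d])]
        exact potential_le_of_small hs' hz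
      · refine (potential_le_of_large hs' hz).trans ?_
        have ht : 0 ≤ x ^ 2 / 16 := by positivity
        gcongr
        split_ifs with h1
        · rw [mul_comm]
          have h2 : 3 / 4 ≤ 1 + x * d / 8 + (x * d / 8) ^ 2 := by
            nlinarith [sq_nonneg (x * d / 8 + 1 / 2)]
          gcongr
          nlinarith
        · have := Real.exp_le_exp.2 (show 3 / 4 * (x ^ 2 / 16) ≤ x ^ 2 / 16 by linarith)
          linarith [Real.exp_pos (x ^ 2 / 16)]
    refine (mul_le_mul_of_nonneg_left key hr2.le).trans (le_of_eq ?_)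
    split_ifs <;> ring

/-- Averaging the quadratic polynomial in `gaussPotential_add_le` over an increment of mean `0` and
variance `s` gives at most the potential before the increment. -/
lemma stepConst_add_le {x v s : ℝ} (hv : 0 ≤ v) :
    stepConst x v s + x ^ 2 / (64 * v) * stepFactor x v s * s ≤ gaussPotential x v := by
  unfold stepConst stepFactor gaussPotential
  split_ifs with h
  · rcases hv.eq_or_lt with rfl | hv0
    · simp
    set y := x ^ 2 * s / (64 * v ^ 2) with hy
    have h1 : x ^ 2 / (64 * v) * s = v * y := by rw [hy]; field_simp
    have h2 : (1 + y) * Real.exp (x ^ 2 / (16 * v) - y) ≤ Real.exp (x ^ 2 / (16 * v)) := by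
      rw [Real.exp_sub, ← mul_div_assoc, div_le_iff₀ (Real.exp_pos _), mul_comm]
      gcongr
      linarith [Real.add_one_le_exp y]
    calc _ = v * ((1 + y) * Real.exp (x ^ 2 / (16 * v) - y)) := by
          rw [mul_right_comm, h1]; ring
      _ ≤ _ := by gcongr
  · simp

lemma stepFactor_le {x v s K : ℝ} (hs : 0 ≤ s) (hv : 0 ≤ v) (hK : 0 ≤ K) (hx : x ^ 2 ≤ K * v) :
    stepFactor x v s ≤ Real.exp K := by
  unfold stepFactor
  split_ifs
  · refine Real.exp_le_exp.2 ?_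
    have h1 : x ^ 2 / (16 * v) ≤ K :=
      div_le_of_le_mul₀ (by positivity) hK (by nlinarith [mul_nonneg hK hv])
    have h2 : 0 ≤ x ^ 2 * s / (64 * v ^ 2) := by positivity
    linarith
  · positivity

lemma gaussPotential_le {x v K : ℝ} (hv : 0 ≤ v) (hK : 0 ≤ K) (hx : x ^ 2 ≤ K * v) :
    gaussPotential x v ≤ Real.exp K * v := by
  unfold gaussPotential
  rw [mul_comm]
  gcongr
  exact div_le_of_le_mul₀ (by positivity) hK (by nlinarith [mul_nonneg hK hv])

/-- Young's inequality for the pair `exp`, `log`, which turns exponential bounds on `N` random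
variables into a bound on their maximum with a factor `log N`. -/
lemma sq_le_log_mul_add_gaussPotential {x v N : ℝ} (hv : 0 ≤ v) (hx : v = 0 → x = 0) (hN : 0 < N) :
    x ^ 2 ≤ 16 * (Real.log N * v + gaussPotential x v / N) := by
  rcases hv.eq_or_lt with hv0 | hv0
  · rw [hx hv0.symm, ← hv0]; simp [gaussPotential]
  · have h := Real.add_one_le_exp (x ^ 2 / (16 * v) - Real.log N)
    rw [Real.exp_sub, Real.exp_log hN] at h
    have h2 := mul_le_mul_of_nonneg_left h hv
    have h3 : v * (x ^ 2 / (16 * v)) = x ^ 2 / 16 := by field_simp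
    unfold gaussPotential
    have h4 : v * (x ^ 2 / (16 * v) - Real.log N + 1) = x ^ 2 / 16 - Real.log N * v + v := by
      rw [← h3]; ring
    rw [h4, ← mul_div_assoc] at h2
    linarith

/-! ### The potential along a square-integrable martingale -/

section Abstract

variable {Ω : Type*} {m m0 : MeasurableSpace Ω} {μ : Measure Ω}

lemma StronglyMeasurable.gaussPotential {X V : Ω → ℝ} (hX : StronglyMeasurable[m] X)
    (hV : StronglyMeasurable[m] V) : StronglyMeasurable[m] fun ω => gaussPotential (X ω) (V ω) := by
  have h1 := hX.measurable
  have h2 := hV.measurable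
  unfold _root_.gaussPotential
  exact Measurable.stronglyMeasurable (by fun_prop)

lemma integrable_gaussPotential {X V : Ω → ℝ} {K : ℝ} (hX : StronglyMeasurable[m0] X)
    (hV : StronglyMeasurable[m0] V) (hVi : Integrable V μ) (hK : 0 ≤ K)
    (hV0 : ∀ᵐ ω ∂μ, 0 ≤ V ω) (hXV : ∀ᵐ ω ∂μ, X ω ^ 2 ≤ K * V ω) :
    Integrable (fun ω => gaussPotential (X ω) (V ω)) μ := by
  refine (hVi.const_mul (Real.exp K)).mono'
    (StronglyMeasurable.gaussPotential hX hV).aestronglyMeasurable ?_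
  filter_upwards [hV0, hXV] with ω h1 h2
  rw [Real.norm_of_nonneg (show 0 ≤ gaussPotential (X ω) (V ω) from
    mul_nonneg h1 (Real.exp_pos _).le)]
  exact gaussPotential_le h1 hK h2

lemma memLp_two_of_sq_le {X V : Ω → ℝ} {K : ℝ} (hX : AEStronglyMeasurable X μ)
    (hVi : Integrable V μ) (hXV : ∀ᵐ ω ∂μ, X ω ^ 2 ≤ K * V ω) : MemLp X 2 μ := by
  rw [memLp_two_iff_integrable_sq hX]
  refine (hVi.const_mul K).mono' (hX.pow 2) ?_
  filter_upwards [hXV] with ω h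
  rwa [Real.norm_of_nonneg (sq_nonneg _)]

lemma integral_mul_of_condExp_eq [IsFiniteMeasure μ] {A Y Z : Ω → ℝ} (hm : m ≤ m0) (hA : StronglyMeasurable[m] A)
    (hY : Integrable Y μ) (hAY : Integrable (fun ω => A ω * Y ω) μ) (hZ : μ[Y | m] =ᵐ[μ] Z) :
    ∫ ω, A ω * Y ω ∂μ = ∫ ω, A ω * Z ω ∂μ := by
  have h1 := condExp_mul_of_stronglyMeasurable_left (μ := μ) hA hAY hY
  have h2 : ∫ ω, A ω * Y ω ∂μ = ∫ ω, (μ[A * Y | m]) ω ∂μ := (integral_condExp hm).symm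
  rw [h2]
  refine integral_congr_ae ?_
  filter_upwards [h1, hZ] with ω e1 e2
  rw [e1, Pi.mul_apply, e2]

/-- Adding a martingale difference `D` to `X` and its square and conditional variance to `V` raises
the mean of the potential by at most a multiple of `∫ D²`. -/
lemma integral_gaussPotential_add_le [IsFiniteMeasure μ] {X V D : Ω → ℝ} {K : ℝ} (hm : m ≤ m0)
    (hX : StronglyMeasurable[m] X) (hV : StronglyMeasurable[m] V) (hVi : Integrable V μ)
    (hK : 0 ≤ K) (hV0 : ∀ᵐ ω ∂μ, 0 ≤ V ω) (hXV : ∀ᵐ ω ∂μ, X ω ^ 2 ≤ K * V ω)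
    (hD : MemLp D 2 μ) (hD0 : μ[D | m] =ᵐ[μ] 0)
    (hU : Integrable (fun ω => gaussPotential (X ω + D ω)
      (V ω + (D ω ^ 2 + (μ[fun ω => D ω ^ 2 | m]) ω))) μ) :
    ∫ ω, gaussPotential (X ω + D ω) (V ω + (D ω ^ 2 + (μ[fun ω => D ω ^ 2 | m]) ω)) ∂μ ≤
      ∫ ω, gaussPotential (X ω) (V ω) ∂μ + 4 * Real.exp 21 * ∫ ω, D ω ^ 2 ∂μ := by
  set S := μ[fun ω => D ω ^ 2 | m] with hS
  have hSm : StronglyMeasurable[m] S := stronglyMeasurable_condExp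
  have hSi : Integrable S μ := integrable_condExp
  have hD2 : Integrable (fun ω => D ω ^ 2) μ := hD.integrable_sq
  have hS0 : ∀ᵐ ω ∂μ, 0 ≤ S ω := condExp_nonneg (Filter.Eventually.of_forall fun ω => sq_nonneg _)
  have hX2 : MemLp X 2 μ := memLp_two_of_sq_le (hX.mono hm).aestronglyMeasurable hVi hXV
  have hU0 := integrable_gaussPotential (hX.mono hm) (hV.mono hm) hVi hK hV0 hXV
  have mX := hX.measurable
  have mV := hV.measurable
  have mS := hSm.measurable
  -- Measurability of the coefficients of the quadratic polynomial in `D`.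
  have mF : Measurable[m] fun ω => stepFactor (X ω) (V ω) (S ω) := by
    unfold stepFactor
    exact Measurable.ite (measurableSet_le mS mV) (by fun_prop) measurable_const
  have mA : Measurable[m] fun ω => stepConst (X ω) (V ω) (S ω) := by
    unfold stepConst
    exact Measurable.ite (measurableSet_le mS mV) (mV.mul mF)
      (StronglyMeasurable.gaussPotential hX hV).measurable
  have mB : Measurable[m] fun ω => X ω / 8 * stepFactor (X ω) (V ω) (S ω) :=
    (mX.div_const 8).mul mF
  have mG : Measurable[m] fun ω => X ω ^ 2 / (64 * V ω) * stepFactor (X ω) (V ω) (S ω) :=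
    ((mX.pow_const 2).div (mV.const_mul 64)).mul mF
  have hFle : ∀ᵐ ω ∂μ, ‖stepFactor (X ω) (V ω) (S ω)‖ ≤ Real.exp K := by
    filter_upwards [hV0, hXV, hS0] with ω h1 h2 h3
    rw [Real.norm_of_nonneg (stepFactor_nonneg _ _ _)]
    exact stepFactor_le h3 h1 hK h2
  have hGle : ∀ᵐ ω ∂μ, ‖X ω ^ 2 / (64 * V ω) * stepFactor (X ω) (V ω) (S ω)‖ ≤
      K * Real.exp K := by
    filter_upwards [hV0, hXV, hFle] with ω h1 h2 h3
    have h4 : 0 ≤ X ω ^ 2 / (64 * V ω) := by positivity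
    rw [norm_mul, Real.norm_of_nonneg h4]
    gcongr
    exact div_le_of_le_mul₀ (by positivity) hK (by nlinarith [mul_nonneg hK h1])
  -- Integrability of the terms of the quadratic polynomial.
  have iB : Integrable (fun ω => X ω / 8 * stepFactor (X ω) (V ω) (S ω) * D ω) μ := by
    have := (hX2.integrable_mul hD).const_mul (1 / 8)
    refine (this.bdd_mul (mF.mono hm le_rfl).aestronglyMeasurable hFle).congr ?_
    filter_upwards with ω
    simp only [Pi.mul_apply]; ring
  have iG : Integrable (fun ω => X ω ^ 2 / (64 * V ω) * stepFactor (X ω) (V ω) (S ω) * D ω ^ 2) μ :=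
    hD2.bdd_mul (mG.mono hm le_rfl).aestronglyMeasurable hGle
  have iGS : Integrable (fun ω => X ω ^ 2 / (64 * V ω) * stepFactor (X ω) (V ω) (S ω) * S ω) μ :=
    hSi.bdd_mul (mG.mono hm le_rfl).aestronglyMeasurable hGle
  have iA : Integrable (fun ω => stepConst (X ω) (V ω) (S ω)) μ := by
    refine hU0.mono' (mA.mono hm le_rfl).aestronglyMeasurable ?_
    filter_upwards [hV0, hS0] with ω h1 h3
    have h4 : 0 ≤ stepConst (X ω) (V ω) (S ω) := by
      unfold stepConst gaussPotential
      have := stepFactor_nonneg (X ω) (V ω) (S ω)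
      split_ifs <;> positivity
    rw [Real.norm_of_nonneg h4]
    refine le_trans ?_ (stepConst_add_le (s := S ω) h1)
    have := stepFactor_nonneg (X ω) (V ω) (S ω)
    have : 0 ≤ X ω ^ 2 / (64 * V ω) * stepFactor (X ω) (V ω) (S ω) * S ω := by positivity
    linarith
  have eB : ∫ ω, X ω / 8 * stepFactor (X ω) (V ω) (S ω) * D ω ∂μ = 0 := by
    rw [integral_mul_of_condExp_eq hm mB.stronglyMeasurable (hD.integrable one_le_two) iB hD0]
    simp
  have eG : ∫ ω, X ω ^ 2 / (64 * V ω) * stepFactor (X ω) (V ω) (S ω) * D ω ^ 2 ∂μ =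
      ∫ ω, X ω ^ 2 / (64 * V ω) * stepFactor (X ω) (V ω) (S ω) * S ω ∂μ :=
    integral_mul_of_condExp_eq hm mG.stronglyMeasurable hD2 iG (ae_eq_refl _)
  have eS : ∫ ω, S ω ∂μ = ∫ ω, D ω ^ 2 ∂μ := integral_condExp hm
  have iDS : Integrable (fun ω => 2 * Real.exp 21 * (D ω ^ 2 + S ω)) μ :=
    (hD2.add hSi).const_mul _
  calc ∫ ω, gaussPotential (X ω + D ω) (V ω + (D ω ^ 2 + S ω)) ∂μ
      ≤ ∫ ω, (stepConst (X ω) (V ω) (S ω) + X ω / 8 * stepFactor (X ω) (V ω) (S ω) * D ω +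
          X ω ^ 2 / (64 * V ω) * stepFactor (X ω) (V ω) (S ω) * D ω ^ 2 +
          2 * Real.exp 21 * (D ω ^ 2 + S ω)) ∂μ := by
        refine integral_mono_ae hU (((iA.fun_add iB).fun_add iG).fun_add iDS) ?_
        filter_upwards [hV0, hS0, hXV] with ω h1 h2 h3
        refine gaussPotential_add_le h2 h1 fun h => ?_
        rw [h, mul_zero] at h3
        exact pow_eq_zero_iff two_ne_zero |>.1 (le_antisymm h3 (sq_nonneg _))
    _ = ∫ ω, (stepConst (X ω) (V ω) (S ω) +
          X ω ^ 2 / (64 * V ω) * stepFactor (X ω) (V ω) (S ω) * S ω) ∂μ +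
          4 * Real.exp 21 * ∫ ω, D ω ^ 2 ∂μ := by
        rw [integral_add ((iA.fun_add iB).fun_add iG) iDS, integral_add (iA.fun_add iB) iG,
          integral_add iA iB, integral_add iA iGS, eB, eG, integral_const_mul,
          integral_add hD2 hSi, eS]
        ring
    _ ≤ _ := by
        gcongr ?_ + _
        refine integral_mono_ae (iA.fun_add iGS) hU0 ?_
        filter_upwards [hV0] with ω h1
        exact stepConst_add_le h1

/-- `g` is a square-integrable martingale difference with respect to the filtration `ℱ`; the mean
value of `g 0` is not prescribed. -/
structure IsSqMartingaleDifference (ℱ : Filtration ℕ m0) (μ : Measure Ω) (g : ℕ → Ω → ℝ) :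
    Prop where
  stronglyMeasurable : ∀ i, StronglyMeasurable[ℱ i] (g i)
  memLp : ∀ i, MemLp (g i) 2 μ
  condExp_eq_zero : ∀ i, μ[g (i + 1) | ℱ i] =ᵐ[μ] 0

/-- The conditional second moment of `g j` given the past, set to `0` for `j = 0`. -/
noncomputable def condSecondMoment (ℱ : Filtration ℕ m0) (μ : Measure Ω) (g : ℕ → Ω → ℝ) :
    ℕ → Ω → ℝ
  | 0 => 0
  | i + 1 => μ[fun ω => g (i + 1) ω ^ 2 | ℱ i]

/-- The sum of the quadratic variation and the conditional quadratic variation of `∑ j ∈ G, g j`. -/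
noncomputable def totalVariance (ℱ : Filtration ℕ m0) (μ : Measure Ω) (g : ℕ → Ω → ℝ)
    (G : Finset ℕ) (ω : Ω) : ℝ :=
  ∑ j ∈ G, (g j ω ^ 2 + condSecondMoment ℱ μ g j ω)

variable {ℱ : Filtration ℕ m0} {g : ℕ → Ω → ℝ}

lemma condSecondMoment_nonneg (j : ℕ) : ∀ᵐ ω ∂μ, 0 ≤ condSecondMoment ℱ μ g j ω := by
  cases j with
  | zero => exact Filter.Eventually.of_forall fun ω => le_rfl
  | succ i => exact condExp_nonneg (Filter.Eventually.of_forall fun ω => sq_nonneg _)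

lemma totalVariance_insert {G : Finset ℕ} {a : ℕ} (ha : a ∉ G) (ω : Ω) :
    totalVariance ℱ μ g (insert a G) ω =
      totalVariance ℱ μ g G ω + (g a ω ^ 2 + condSecondMoment ℱ μ g a ω) := by
  rw [totalVariance, Finset.sum_insert ha, add_comm]; rfl

lemma totalVariance_nonneg (G : Finset ℕ) : ∀ᵐ ω ∂μ, 0 ≤ totalVariance ℱ μ g G ω := by
  filter_upwards [ae_all_iff.2 fun j => condSecondMoment_nonneg (ℱ := ℱ) (μ := μ) (g := g) j]
    with ω h
  exact Finset.sum_nonneg fun j _ => add_nonneg (sq_nonneg _) (h j)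

lemma totalVariance_mono {G H : Finset ℕ} (hGH : G ⊆ H) :
    ∀ᵐ ω ∂μ, totalVariance ℱ μ g G ω ≤ totalVariance ℱ μ g H ω := by
  filter_upwards [ae_all_iff.2 fun j => condSecondMoment_nonneg (ℱ := ℱ) (μ := μ) (g := g) j]
    with ω h
  exact Finset.sum_le_sum_of_subset_of_nonneg hGH
    fun j _ _ => add_nonneg (sq_nonneg _) (h j)

lemma sq_sum_le_totalVariance (G : Finset ℕ) :
    ∀ᵐ ω ∂μ, (∑ j ∈ G, g j ω) ^ 2 ≤ (G.card : ℝ) * totalVariance ℱ μ g G ω := by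
  filter_upwards [ae_all_iff.2 fun j => condSecondMoment_nonneg (ℱ := ℱ) (μ := μ) (g := g) j]
    with ω h
  refine sq_sum_le_card_mul_sum_sq.trans ?_
  unfold totalVariance
  gcongr with j _
  linarith [h j]

namespace IsSqMartingaleDifference

lemma stronglyMeasurable_condSecondMoment (j i : ℕ) (hj : j ≤ i + 1) :
    StronglyMeasurable[ℱ i] (condSecondMoment ℱ μ g j) := by
  cases j with
  | zero => exact stronglyMeasurable_zero
  | succ k => exact stronglyMeasurable_condExp.mono (ℱ.mono (by omega))

lemma stronglyMeasurable_totalVariance (hg : IsSqMartingaleDifference ℱ μ g) {G : Finset ℕ} {i : ℕ}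
    (hG : ∀ j ∈ G, j ≤ i) : StronglyMeasurable[ℱ i] (totalVariance ℱ μ g G) := by
  unfold totalVariance
  refine Finset.stronglyMeasurable_fun_sum _ fun j hj => ?_
  exact (((hg.stronglyMeasurable j).mono (ℱ.mono (hG j hj))).pow 2).add
    (stronglyMeasurable_condSecondMoment j i (by have := hG j hj; omega))

lemma stronglyMeasurable_sum (hg : IsSqMartingaleDifference ℱ μ g) {G : Finset ℕ} {i : ℕ}
    (hG : ∀ j ∈ G, j ≤ i) : StronglyMeasurable[ℱ i] fun ω => ∑ j ∈ G, g j ω :=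
  Finset.stronglyMeasurable_fun_sum _ fun j hj => (hg.stronglyMeasurable j).mono (ℱ.mono (hG j hj))

lemma integrable_condSecondMoment (j : ℕ) : Integrable (condSecondMoment ℱ μ g j) μ := by
  cases j with
  | zero => exact integrable_zero _ _ _
  | succ k => exact integrable_condExp

lemma integrable_totalVariance (hg : IsSqMartingaleDifference ℱ μ g) (G : Finset ℕ) :
    Integrable (totalVariance ℱ μ g G) μ :=
  integrable_finsetSum _ fun j _ => (hg.memLp j).integrable_sq.add (integrable_condSecondMoment j)

lemma memLp_sum (hg : IsSqMartingaleDifference ℱ μ g) (G : Finset ℕ) :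
    MemLp (fun ω => ∑ j ∈ G, g j ω) 2 μ :=
  memLp_finsetSum _ fun j _ => hg.memLp j

lemma integrable_gaussPotential (hg : IsSqMartingaleDifference ℱ μ g) (G : Finset ℕ) :
    Integrable (fun ω => gaussPotential (∑ j ∈ G, g j ω) (totalVariance ℱ μ g G ω)) μ :=
  _root_.integrable_gaussPotential
    ((hg.stronglyMeasurable_sum fun _ hj => Finset.le_sup (f := id) hj).mono (ℱ.le _))
    ((hg.stronglyMeasurable_totalVariance fun _ hj => Finset.le_sup (f := id) hj).mono (ℱ.le _))
    (hg.integrable_totalVariance G) (Nat.cast_nonneg G.card) (totalVariance_nonneg G)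
    (sq_sum_le_totalVariance G)

variable [IsFiniteMeasure μ]

lemma integral_totalVariance_le (hg : IsSqMartingaleDifference ℱ μ g) (G : Finset ℕ) :
    ∫ ω, totalVariance ℱ μ g G ω ∂μ ≤ 2 * ∑ j ∈ G, ∫ ω, g j ω ^ 2 ∂μ := by
  unfold totalVariance
  rw [integral_finsetSum _ fun j _ =>
    (hg.memLp j).integrable_sq.fun_add (integrable_condSecondMoment j), Finset.mul_sum]
  refine Finset.sum_le_sum fun j _ => ?_
  rw [integral_add (hg.memLp j).integrable_sq (integrable_condSecondMoment j), two_mul]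
  gcongr _ + ?_
  cases j with
  | zero =>
    simp only [condSecondMoment, Pi.zero_apply, integral_zero]
    exact integral_nonneg fun ω => sq_nonneg (g 0 ω)
  | succ i => exact (integral_condExp (ℱ.le i)).le

lemma integral_sq_sum (hg : IsSqMartingaleDifference ℱ μ g) (G : Finset ℕ) :
    ∫ ω, (∑ j ∈ G, g j ω) ^ 2 ∂μ = ∑ j ∈ G, ∫ ω, g j ω ^ 2 ∂μ := by
  induction G using Finset.induction_on_max with
  | empty => simp
  | insert a G hlt ih =>
    have ha : a ∉ G := fun h => lt_irrefl a (hlt a h)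
    rw [Finset.sum_insert ha, ← ih]
    have i1 : Integrable (fun ω => (∑ j ∈ G, g j ω) * g a ω) μ :=
      (hg.memLp_sum G).integrable_mul (hg.memLp a)
    have i2 := (hg.memLp a).integrable_sq
    have i3 := (hg.memLp_sum G).integrable_sq
    have hcross : ∫ ω, (∑ j ∈ G, g j ω) * g a ω ∂μ = 0 := by
      cases a with
      | zero =>
        have : G = ∅ := Finset.eq_empty_of_forall_notMem fun x hx => by simpa using hlt x hx
        simp [this]
      | succ i =>
        rw [integral_mul_of_condExp_eq (ℱ.le i)
          (hg.stronglyMeasurable_sum fun j hj => Nat.lt_succ_iff.1 (hlt j hj))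
          ((hg.memLp _).integrable one_le_two) i1 (hg.condExp_eq_zero i)]
        simp
    have : ∀ ω, (∑ j ∈ insert a G, g j ω) ^ 2 =
        g a ω ^ 2 + (∑ j ∈ G, g j ω) ^ 2 + 2 * ((∑ j ∈ G, g j ω) * g a ω) := by
      intro ω; rw [Finset.sum_insert ha]; ring
    simp_rw [this]
    rw [integral_add (i2.fun_add i3) (i1.const_mul 2), integral_add i2 i3, integral_const_mul,
      hcross, mul_zero, add_zero]

/-- The self-normalized exponential inequality: the sum `X` of the `g j`, `j ∈ G`, and its total
variance `V` satisfy `∫ V exp (X² / (16 V)) ≤ C ∫ X²`. -/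
lemma integral_gaussPotential_le (hg : IsSqMartingaleDifference ℱ μ g) (G : Finset ℕ) :
    ∫ ω, gaussPotential (∑ j ∈ G, g j ω) (totalVariance ℱ μ g G ω) ∂μ ≤
      4 * Real.exp 21 * ∑ j ∈ G, ∫ ω, g j ω ^ 2 ∂μ := by
  induction G using Finset.induction_on_max with
  | empty => simp [totalVariance, gaussPotential]
  | insert a G hlt ih =>
    have ha : a ∉ G := fun h => lt_irrefl a (hlt a h)
    have hU := hg.integrable_gaussPotential (insert a G)
    cases a with
    | zero =>
      have hG : G = ∅ := Finset.eq_empty_of_forall_notMem fun x hx => by simpa using hlt x hx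
      subst hG
      rw [Finset.sum_insert ha, Finset.sum_empty, add_zero, ← integral_const_mul]
      refine integral_mono hU ((hg.memLp 0).integrable_sq.const_mul _) fun ω => ?_
      have h1 := gaussPotential_le (x := g 0 ω) (v := g 0 ω ^ 2) (K := 1) (sq_nonneg _)
        zero_le_one (by rw [one_mul])
      have h2 := Real.exp_le_exp.2 (show (1 : ℝ) ≤ 21 by norm_num)
      simp only [totalVariance, condSecondMoment, insert_empty_eq, Finset.sum_singleton,
        Pi.zero_apply, add_zero]
      nlinarith [sq_nonneg (g 0 ω), Real.exp_pos 21]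
    | succ i =>
      have hle : ∀ j ∈ G, j ≤ i := fun j hj => Nat.lt_succ_iff.1 (hlt j hj)
      have e1 : ∀ ω, gaussPotential (∑ j ∈ insert (i + 1) G, g j ω)
          (totalVariance ℱ μ g (insert (i + 1) G) ω) =
          gaussPotential (∑ j ∈ G, g j ω + g (i + 1) ω) (totalVariance ℱ μ g G ω +
            (g (i + 1) ω ^ 2 + (μ[fun ω => g (i + 1) ω ^ 2 | ℱ i]) ω)) := by
        intro ω
        rw [Finset.sum_insert ha, totalVariance_insert ha, add_comm (g (i + 1) ω)]
        rfl
      simp_rw [e1] at hU ⊢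
      have := integral_gaussPotential_add_le (ℱ.le i) (hg.stronglyMeasurable_sum hle)
        (hg.stronglyMeasurable_totalVariance hle) (hg.integrable_totalVariance G)
        (Nat.cast_nonneg G.card) (totalVariance_nonneg G) (sq_sum_le_totalVariance G)
        (hg.memLp (i + 1)) (hg.condExp_eq_zero i) hU
      rw [Finset.sum_insert ha]
      linarith

/-- The maximal inequality for the sums over arbitrary subsets `G m` of `H`, where `Q` is, up to
sign, at each point one of these sums. -/
lemma integral_sq_max_le (hg : IsSqMartingaleDifference ℱ μ g) {n : ℕ} (hn : 1 ≤ n)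
    {G : ℕ → Finset ℕ} {H : Finset ℕ} (hG : ∀ m ∈ Finset.Icc 1 n, G m ⊆ H) {Q : Ω → ℝ}
    (hQm : AEStronglyMeasurable Q μ)
    (hQ : ∀ ω, ∃ m ∈ Finset.Icc 1 n, Q ω ^ 2 = (∑ j ∈ G m, g j ω) ^ 2) :
    MemLp Q 2 μ ∧ ∫ ω, Q ω ^ 2 ∂μ ≤
      16 * (2 * Real.log n + 4 * Real.exp 21) * ∫ ω, (∑ j ∈ H, g j ω) ^ 2 ∂μ := by
  have hn0 : (0 : ℝ) < n := by exact_mod_cast hn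
  have hlog : 0 ≤ Real.log n := Real.log_nonneg (by exact_mod_cast hn)
  set W : Ω → ℝ := fun ω => 16 * (Real.log n * totalVariance ℱ μ g H ω +
    (∑ m ∈ Finset.Icc 1 n, gaussPotential (∑ j ∈ G m, g j ω) (totalVariance ℱ μ g (G m) ω)) / n)
    with hW
  have i1 := (hg.integrable_totalVariance H).const_mul (Real.log n)
  have i2 := (integrable_finsetSum (Finset.Icc 1 n)
    fun m _ => hg.integrable_gaussPotential (G m)).div_const (n : ℝ)
  have hWi : Integrable W μ := (i1.fun_add i2).const_mul 16
  have hle : ∀ᵐ ω ∂μ, Q ω ^ 2 ≤ W ω := by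
    have a1 : ∀ᵐ ω ∂μ, ∀ m, 0 ≤ totalVariance ℱ μ g (G m) ω :=
      ae_all_iff.2 fun m => totalVariance_nonneg (G m)
    have a2 : ∀ᵐ ω ∂μ, ∀ m, (∑ j ∈ G m, g j ω) ^ 2 ≤
        ((G m).card : ℝ) * totalVariance ℱ μ g (G m) ω :=
      ae_all_iff.2 fun m => sq_sum_le_totalVariance (G m)
    have a3 : ∀ᵐ ω ∂μ, ∀ m : Finset.Icc 1 n,
        totalVariance ℱ μ g (G m) ω ≤ totalVariance ℱ μ g H ω :=
      ae_all_iff.2 fun m => totalVariance_mono (hG m m.2)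
    filter_upwards [a1, a2, a3] with ω h1 h2 h3
    obtain ⟨m, hm, hQm⟩ := hQ ω
    have hpot : ∀ k, 0 ≤ gaussPotential (∑ j ∈ G k, g j ω) (totalVariance ℱ μ g (G k) ω) :=
      fun k => mul_nonneg (h1 k) (Real.exp_pos _).le
    have h4 := sq_le_log_mul_add_gaussPotential (x := ∑ j ∈ G m, g j ω) (h1 m) (fun h => by
      have := h2 m
      rw [h, mul_zero] at this
      exact pow_eq_zero_iff two_ne_zero |>.1 (le_antisymm this (sq_nonneg _))) hn0
    rw [hQm]
    refine h4.trans ?_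
    simp only [hW]
    gcongr
    · exact h3 ⟨m, hm⟩
    · exact Finset.single_le_sum
        (f := fun k => gaussPotential (∑ j ∈ G k, g j ω) (totalVariance ℱ μ g (G k) ω))
        (fun k _ => hpot k) hm
  have hQL : MemLp Q 2 μ :=
    memLp_two_of_sq_le (K := 1) hQm hWi (by simpa only [one_mul] using hle)
  refine ⟨hQL, (integral_mono_ae hQL.integrable_sq hWi hle).trans ?_⟩
  set T := ∑ j ∈ H, ∫ ω, g j ω ^ 2 ∂μ with hT
  have hpot : ∀ m ∈ Finset.Icc 1 n,
      ∫ ω, gaussPotential (∑ j ∈ G m, g j ω) (totalVariance ℱ μ g (G m) ω) ∂μ ≤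
        4 * Real.exp 21 * T := by
    intro m hm
    refine (hg.integral_gaussPotential_le (G m)).trans ?_
    gcongr
    exact Finset.sum_le_sum_of_subset_of_nonneg (hG m hm)
      fun j _ _ => integral_nonneg fun ω => sq_nonneg _
  have hsum := Finset.sum_le_card_nsmul _ _ _ hpot
  rw [Nat.card_Icc, Nat.add_sub_cancel, nsmul_eq_mul] at hsum
  rw [hg.integral_sq_sum H, ← hT, hW, integral_const_mul, integral_add i1 i2, integral_const_mul,
    integral_div, integral_finsetSum _ fun m _ => hg.integrable_gaussPotential (G m)]
  have h1 := mul_le_mul_of_nonneg_left (hg.integral_totalVariance_le H) hlog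
  have h2 := (div_le_iff₀' hn0).2 hsum
  rw [← hT] at h1
  linarith

end IsSqMartingaleDifference

end Abstract

/-! ### The filtration generated by partitions of the unit interval -/

instance : IsProbabilityMeasure unitMeasure :=
  ⟨by rw [unitMeasure, Measure.restrict_apply_univ, Real.volume_Ico]; simp⟩

lemma ae_mem_Ico_unitMeasure : ∀ᵐ x ∂unitMeasure, x ∈ Set.Ico (0 : ℝ) 1 :=
  ae_restrict_mem measurableSet_Ico

/-- The σ-algebra of the Borel sets of `ℝ` that do not split any set of `Q`. There is no condition
outside the union of `Q`. -/
abbrev unsplitSpace (Q : Set (Set ℝ)) : MeasurableSpace ℝ where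
  MeasurableSet' S := MeasurableSet S ∧ ∀ A ∈ Q, A ⊆ S ∨ Disjoint A S
  measurableSet_empty := ⟨MeasurableSet.empty, fun _ _ => Or.inr (Set.disjoint_empty _)⟩
  measurableSet_compl S hS := ⟨hS.1.compl, fun A hA => by
    rcases hS.2 A hA with h | h
    · exact Or.inr (Set.disjoint_compl_right_iff_subset.2 h)
    · exact Or.inl (Set.subset_compl_iff_disjoint_right.2 h)⟩
  measurableSet_iUnion S hS := ⟨MeasurableSet.iUnion fun i => (hS i).1, fun A hA => by
    by_cases h : ∃ i, A ⊆ S i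
    · obtain ⟨i, hi⟩ := h
      exact Or.inl (hi.trans (Set.subset_iUnion S i))
    · push Not at h
      exact Or.inr (Set.disjoint_iUnion_right.2 fun i => ((hS i).2 A hA).resolve_left (h i))⟩

namespace IsUnitPartition

lemma subset_Ico {Q : Set (Set ℝ)} (hQ : IsUnitPartition Q) {A : Set ℝ} (hA : A ∈ Q) :
    A ⊆ Set.Ico 0 1 := by
  rw [← hQ.sUnion_eq]; exact Set.subset_sUnion_of_mem hA

/-- A set that does not split the sets of a partition is, inside `[0,1)`, the union of those sets
of the partition that it contains. -/
lemma inter_Ico_eq {Q : Set (Set ℝ)} (hQ : IsUnitPartition Q) {S : Set ℝ}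
    (hS : ∀ A ∈ Q, A ⊆ S ∨ Disjoint A S) : S ∩ Set.Ico 0 1 = ⋃₀ {A ∈ Q | A ⊆ S} := by
  ext x
  constructor
  · rintro ⟨hx, hx1⟩
    rw [← hQ.sUnion_eq] at hx1
    obtain ⟨A, hA, hxA⟩ := hx1
    exact ⟨A, ⟨hA, (hS A hA).resolve_right fun h => Set.disjoint_left.1 h hxA hx⟩, hxA⟩
  · rintro ⟨A, ⟨hA, hAS⟩, hxA⟩
    exact ⟨hAS hxA, hQ.subset_Ico hA hxA⟩

/-- A function that vanishes off `[0,1)` and is constant on the sets of a partition is measurable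
with respect to the σ-algebra of the partition. -/
lemma measurable_indicator {Q : Set (Set ℝ)} (hQ : IsUnitPartition Q) {f : ℝ → ℝ}
    (hf : ∀ A ∈ Q, ∀ x ∈ A, ∀ y ∈ A, f x = f y) :
    Measurable[unsplitSpace Q] ((Set.Ico 0 1).indicator f) := by
  have hunion : ∀ R ⊆ Q, MeasurableSet[unsplitSpace Q] (⋃₀ R) := fun R hR => by
    refine ⟨MeasurableSet.sUnion (hQ.countable.mono hR) fun A hA => hQ.measurableSet A (hR hA),
      fun A hA => ?_⟩
    by_cases h : A ∈ R
    · exact Or.inl (Set.subset_sUnion_of_mem h)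
    · refine Or.inr (Set.disjoint_sUnion_right.2 fun B hB => ?_)
      exact hQ.pairwiseDisjoint hA (hR hB) fun e => h (e ▸ hB)
  have hIco : MeasurableSet[unsplitSpace Q] (Set.Ico (0 : ℝ) 1) := by
    rw [← hQ.sUnion_eq]; exact hunion Q subset_rfl
  intro T _
  rw [Set.indicator_preimage, Set.ite, Set.sdiff_eq]
  refine MeasurableSet.union ?_ (MeasurableSet.inter ?_ hIco.compl)
  · have : f ⁻¹' T ∩ Set.Ico 0 1 = ⋃₀ {A ∈ Q | A ⊆ f ⁻¹' T} := by
      refine hQ.inter_Ico_eq fun A hA => ?_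
      by_cases h : ∃ x ∈ A, f x ∈ T
      · obtain ⟨x, hx, hxT⟩ := h
        exact Or.inl fun y hy => by rw [Set.mem_preimage, hf A hA y hy x hx]; exact hxT
      · push Not at h
        exact Or.inr (Set.disjoint_left.2 h)
    rw [this]
    exact hunion _ (Set.sep_subset _ _)
  · by_cases h : (0 : ℝ) ∈ T
    · convert MeasurableSet.univ
      ext x; simpa using h
    · convert MeasurableSet.empty
      ext x; simpa using h

/-- A function whose integral over each set of a partition is `0` has conditional expectation `0`.
-/
lemma condExp_eq_zero {Q : Set (Set ℝ)} (hQ : IsUnitPartition Q) {f : ℝ → ℝ}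
    (hfi : Integrable f unitMeasure) (hf : ∀ A ∈ Q, ∫ x in A, f x = 0) :
    unitMeasure[f | unsplitSpace Q] =ᵐ[unitMeasure] 0 := by
  have hm : unsplitSpace Q ≤ (inferInstance : MeasurableSpace ℝ) := fun S hS => hS.1
  refine (ae_eq_condExp_of_forall_setIntegral_eq hm hfi
    (fun _ _ _ => integrableOn_zero) (fun S hS _ => ?_)
    aestronglyMeasurable_zero).symm
  have hR : {A ∈ Q | A ⊆ S} ⊆ Q := Set.sep_subset _ _
  have : Countable {A ∈ Q | A ⊆ S} := (hQ.countable.mono hR).to_subtype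
  rw [unitMeasure, Measure.restrict_restrict hS.1, hQ.inter_Ico_eq hS.2, Set.sUnion_eq_iUnion,
    integral_iUnion, integral_iUnion]
  · refine tsum_congr fun A => ?_
    rw [hf A (hR A.2)]; simp
  · exact fun A => hQ.measurableSet A (hR A.2)
  · exact fun A B hAB => hQ.pairwiseDisjoint (hR A.2) (hR B.2) fun e => hAB (Subtype.ext e)
  · rw [← Set.sUnion_eq_iUnion, ← hQ.inter_Ico_eq hS.2]
    exact (show IntegrableOn f (Set.Ico 0 1) volume from hfi).mono_set Set.inter_subset_right
  · exact fun A => hQ.measurableSet A (hR A.2)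
  · exact fun A B hAB => hQ.pairwiseDisjoint (hR A.2) (hR B.2) fun e => hAB (Subtype.ext e)
  · exact integrableOn_zero

end IsUnitPartition

/-- The filtration of σ-algebras attached to a filtration of partitions. -/
def IsPartitionFiltration.toFiltration {P : ℕ → Set (Set ℝ)} (hP : IsPartitionFiltration P) :
    Filtration ℕ (inferInstance : MeasurableSpace ℝ) where
  seq n := unsplitSpace (P n)
  mono' := by
    refine monotone_nat_of_le_succ fun n S hS => ⟨hS.1, fun B hB => ?_⟩
    rcases B.eq_empty_or_nonempty with rfl | ⟨x, hx⟩
    · exact Or.inl (Set.empty_subset _)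
    have hxI := (hP.isUnitPartition (n + 1)).subset_Ico hB hx
    rw [← (hP.isUnitPartition n).sUnion_eq] at hxI
    obtain ⟨A, hA, hxA⟩ := hxI
    have hBA : B ⊆ A := by
      obtain ⟨R, hR, rfl⟩ := hP.children n A hA
      obtain ⟨B', hB', hxB'⟩ := hxA
      have : B = B' := (hP.isUnitPartition (n + 1)).pairwiseDisjoint.elim hB (hR hB')
        (Set.not_disjoint_iff.2 ⟨x, hx, hxB'⟩)
      exact this ▸ Set.subset_sUnion_of_mem hB'
    exact (hS.2 A hA).imp hBA.trans fun h => h.mono_left hBA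
  le' n S hS := hS.1

/-- Multiples of the functions of a martingale difference based on partitions, cut off outside
`[0,1)`, form a martingale difference for the σ-algebras of the partitions. -/
lemma IsMartingaleDifferenceOn.isSqMartingaleDifference {P : ℕ → Set (Set ℝ)} {f : ℕ → ℝ → ℝ}
    (h : IsMartingaleDifferenceOn P f) (hf : ∀ j, MemLp (f j) 2 unitMeasure) (c : ℕ → ℝ) :
    IsSqMartingaleDifference h.filtration.toFiltration unitMeasure
      (fun j x => c j * (Set.Ico 0 1).indicator (f j) x) where
  stronglyMeasurable i := (((h.filtration.isUnitPartition i).measurable_indicator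
    (h.const i)).const_mul (c i)).stronglyMeasurable
  memLp i := ((hf i).indicator measurableSet_Ico).const_mul (c i)
  condExp_eq_zero i := by
    have e1 : (fun x => c (i + 1) * (Set.Ico 0 1).indicator (f (i + 1)) x) =ᵐ[unitMeasure]
        c (i + 1) • f (i + 1) := by
      filter_upwards [ae_mem_Ico_unitMeasure] with x hx
      rw [Set.indicator_of_mem hx]; rfl
    refine (condExp_congr_ae e1).trans ((condExp_smul _ _ _).trans ?_)
    filter_upwards [(h.filtration.isUnitPartition i).condExp_eq_zero (h.integrable (i + 1))
      (h.integral_eq_zero i)] with x hx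
    have hx' : (unitMeasure[f (i + 1) | h.filtration.toFiltration i]) x = 0 := hx
    rw [Pi.smul_apply, hx', smul_zero, Pi.zero_apply]

/-! ### The maximal inequality for monotonic sequences -/

lemma exists_maxAbs_sq_eq {n : ℕ} (hn : 1 ≤ n) (p : ℕ → ℝ → ℝ) (x : ℝ) :
    ∃ m ∈ Finset.Icc 1 n, maxAbs n p x ^ 2 = p m x ^ 2 := by
  obtain ⟨m, hm, h⟩ := Finset.exists_mem_eq_sup (Finset.Icc 1 n) ⟨1, by simpa using hn⟩
    fun m => ‖p m x‖₊
  refine ⟨m, hm, ?_⟩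
  rw [maxAbs, h, coe_nnnorm, Real.norm_eq_abs, sq_abs]

lemma measurable_maxAbs {n : ℕ} {p : ℕ → ℝ → ℝ} (hp : ∀ m, Measurable (p m)) :
    Measurable (maxAbs n p) := by
  unfold maxAbs
  refine Measurable.coe_nnreal_real ?_
  induction Finset.Icc 1 n using Finset.induction_on with
  | empty => simp
  | insert a T _ ih =>
    simp only [Finset.sup_insert]
    exact (hp a).nnnorm.sup ih

lemma eLpNorm_two_eq_sqrt {Ω : Type*} {m0 : MeasurableSpace Ω} {μ : Measure Ω} {f : Ω → ℝ}
    (hf : MemLp f 2 μ) : eLpNorm f 2 μ = ENNReal.ofReal √(∫ x, f x ^ 2 ∂μ) := by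
  rw [hf.eLpNorm_eq_integral_rpow_norm two_ne_zero ENNReal.ofNat_ne_top, Real.sqrt_eq_rpow]
  simp

lemma eLpNorm_maxAbs_systemPoly_le {f : ℕ → ℝ → ℝ} (h : IsMartingaleDifference f)
    (hf : ∀ j, MemLp (f j) 2 unitMeasure) {n : ℕ} (hn : 2 ≤ n) (c : ℕ → ℝ) {G : ℕ → Finset ℕ}
    (hG : MonotoneOn G (Set.Icc 1 n)) :
    eLpNorm (maxAbs n (fun m => systemPoly f c (G m))) 2 unitMeasure ≤
      ENNReal.ofReal (√(16 * (2 + 4 * Real.exp 21)) * √(Real.logb 2 n)) *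
        eLpNorm (systemPoly f c (G n)) 2 unitMeasure := by
  obtain ⟨P, hP⟩ := h
  have hn1 : 1 ≤ n := by omega
  set f' : ℕ → ℝ → ℝ := fun j => (Set.Ico 0 1).indicator (f j) with hf'
  have hg := hP.isSqMartingaleDifference hf c
  have hpoly : ∀ x ∈ Set.Ico (0 : ℝ) 1, ∀ H, systemPoly f c H x = systemPoly f' c H x := by
    intro x hx H
    unfold systemPoly
    refine Finset.sum_congr rfl fun j _ => ?_
    simp only [hf', Set.indicator_of_mem hx]
  have e1 : maxAbs n (fun m => systemPoly f c (G m)) =ᵐ[unitMeasure]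
      maxAbs n (fun m => systemPoly f' c (G m)) := by
    filter_upwards [ae_mem_Ico_unitMeasure] with x hx
    simp only [maxAbs, hpoly x hx]
  have e2 : systemPoly f c (G n) =ᵐ[unitMeasure] systemPoly f' c (G n) := by
    filter_upwards [ae_mem_Ico_unitMeasure] with x hx
    exact hpoly x hx _
  rw [eLpNorm_congr_ae e1, eLpNorm_congr_ae e2]
  have hmeas : ∀ m, Measurable (systemPoly f' c (G m)) := fun m =>
    Finset.measurable_fun_sum _ fun j _ =>
      ((hg.stronglyMeasurable j).mono (hP.filtration.toFiltration.le j)).measurable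
  obtain ⟨hQ, hle⟩ := hg.integral_sq_max_le hn1 (G := G) (H := G n)
    (fun m hm => hG (Finset.mem_Icc.1 hm) ⟨hn1, le_rfl⟩ (Finset.mem_Icc.1 hm).2)
    (measurable_maxAbs hmeas).aestronglyMeasurable
    (fun x => exists_maxAbs_sq_eq hn1 (fun m => systemPoly f' c (G m)) x)
  have hlog1 : 1 ≤ Real.logb 2 n := by
    rw [Real.le_logb_iff_rpow_le one_lt_two (by positivity)]
    simpa using (show (2 : ℝ) ≤ n by exact_mod_cast hn)
  have hlog2 : Real.log n ≤ Real.logb 2 n := by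
    have h2 : Real.log 2 ≤ 1 := by linarith [Real.log_two_lt_d9]
    have h0 : 0 ≤ Real.log n := Real.log_nonneg (by exact_mod_cast hn1)
    rw [Real.logb, le_div_iff₀ (Real.log_pos one_lt_two)]
    nlinarith
  rw [eLpNorm_two_eq_sqrt hQ, eLpNorm_two_eq_sqrt (f := systemPoly f' c (G n)) (hg.memLp_sum (G n)),
    ← ENNReal.ofReal_mul (by positivity), ← Real.sqrt_mul (by positivity),
    ← Real.sqrt_mul (by positivity)]
  refine ENNReal.ofReal_le_ofReal (Real.sqrt_le_sqrt (hle.trans ?_))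
  refine mul_le_mul_of_nonneg_right ?_ (integral_nonneg fun x => sq_nonneg _)
  nlinarith [Real.exp_pos 21]

theorem theorem1 :
    ∃ C : ℝ, 0 < C ∧
      ∀ f : ℕ → ℝ → ℝ, IsMartingaleDifference f → (∀ j, MemLp (f j) 2 unitMeasure) →
        ∀ n : ℕ, 2 ≤ n →
          (∀ (c : ℕ → ℝ) (G : ℕ → Finset ℕ), MonotoneOn G (Set.Icc 1 n) →
            eLpNorm (maxAbs n (fun m => systemPoly f c (G m))) 2 unitMeasure ≤
              ENNReal.ofReal (C * Real.sqrt (Real.logb 2 n)) *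
                eLpNorm (systemPoly f c (G n)) 2 unitMeasure) ∧
          kappa n f ≤ ENNReal.ofReal (C * Real.sqrt (Real.logb 2 n)) := by
  refine ⟨√(16 * (2 + 4 * Real.exp 21)), by positivity, fun f h hf n hn =>
    ⟨fun c G hG => eLpNorm_maxAbs_systemPoly_le h hf hn c hG, ?_⟩⟩
  refine iSup_le fun c => iSup_le fun G => iSup_le fun hG => iSup_le fun _ => ?_
  exact ENNReal.div_le_of_le_mul (eLpNorm_maxAbs_systemPoly_le h hf hn c hG)
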